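/- Let $\Bbbk$ be a field, $n\ge 1$, and let $P$ be the poset $\{1,\dots,n\}\times\{1,2\}$ with the product order (the commutative ladder); write $x_a=(a,1)$ and $y_a=(a,2)$. Let $A=\Bbbk P$ be its incidence algebra; finite-dimensional $A$-modules are identified with functors from the poset $P$ to finite-dimensional $\Bbbk$-vector spaces. Let $\mathbb I$ be the set of intervals of $P$ (nonempty convex subsets that are connected in the Hasse diagram), and for $I\in\mathbb I$ let $V_I$ be the interval module with support $I$: it is $\Bbbk$ on $I$ and $0$ elsewhere, with identity maps inside $I$. A module is interval-decomposable if it is isomorphic to a finite direct sum (possibly zero) of interval modules. A right approximation of a module $N$ by interval-decomposable modules is a morphism $f\colon X\to N$ with $X$ interval-decomposable such that every morphism $Y\to N$ with $Y$ interval-decomposable factors through $f$. An interval resolution of $M$ is a sequence $$0\to \bigoplus_{J\in\mathbb I}V_J^{d_J^{(r)}}\xrightarrow{f_r}\cdots\xrightarrow{f_2}\bigoplus_{J\in\mathbb I}V_J^{d_J^{(1)}}\xrightarrow{f_1}\bigoplus_{J\in\mathbb I}V_J^{d_J^{(0)}}\xrightarrow{f_0}M\to 0$$ with $r, d_J^{(i)}\in\mathbb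 Z_{\ge 0}$, in which $f_0$ is a right approximation of $M$ and, for every $i\ge1$, $f_i$ is a right approximation of $\operatorname{Ker} f_{i-1}$ by interval-decomposable modules (terms in degrees above $r$ being zero; in particular the sequence is exact). Let $Q'$ be the quiver $1\xleftarrow{\alpha_1}2\xrightarrow{\alpha_2}3\xleftarrow{\alpha_3}4\xrightarrow{\alpha_4}5$ and $B=\Bbbk Q'$. For $I\in\mathbb I$, let $x_i,x_j$ be the first and last vertices of $I$ in the lower row and $y_k,y_l$ those in the upper row, as far as $I$ meets these rows. Let $\xi_I$ be the quiver morphism from $Q'$ to the category $P$ that sends the vertices $1,2,3,4,5$ to $y_l,y_k,y_i,x_i,x_j$ if $I$ meets both rows, to $x_j,x_i,x_i,x_i,x_j$ if $I$ lies in the lower row, and to $y_l,y_k,y_k,y_k,y_l$ if $I$ lies in the upper row, and each arrow to the unique morphism of $P$ between the images of its ends. Let $F_I$ be the functor from the path category of $Q'$ to $P$ extending $\xi_I$, and let $R_I(M)=M\circ F_I$ be the restriction of $M$ along $F_I$, a finite-dimensional $B$-module. The compressed multiplicity $c_M^\xi(I)$ is the multiplicity of $R_I(V_I)$ in $R_I(M)$,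 i.e. the number of summands isomorphic to $R_I(V_I)$ in a decomposition of $R_I(M)$ into a finite direct sum of indecomposable modules (which exists and is unique up to isomorphism and order by the Krull–Schmidt theorem). **Theorem.** Let $M$ be a finite-dimensional $A$-module with an interval resolution as above. Then for every $I\in\mathbb I$ $$c_M^{\xi}(I)=\sum_{J\in\mathbb I,\ I\subseteq J}\ \sum_{i=0}^{r}(-1)^i d_J^{(i)} .$$ -/

import Mathlib

open CategoryTheory CategoryTheory.Limits

universe u

attribute [local instance] Abelian.hasFiniteBiproducts
attribute [-instance] ReflQuiver.toQuiver

/-! ### Intervals of a finite poset and interval modules -/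

/-- An interval of a poset `P`: a (nonempty) convex subset that is connected as a full subgraph of
the Hasse diagram of `P`.  (`SimpleGraph.Connected` includes nonemptiness.) -/
def IsPosetInterval {P : Type*} [PartialOrder P] (S : Set P) : Prop :=
  ((SimpleGraph.hasse P).induce S).Connected ∧ S.OrdConnected

/-- The set `𝕀(P)` of all intervals of `P`, partially ordered by inclusion. -/
abbrev PosetInterval (P : Type*) [PartialOrder P] : Type _ :=
  {S : Set P // IsPosetInterval S}

noncomputable instance {P : Type*} [PartialOrder P] [Finite P] : Fintype (PosetInterval P) :=
  Fintype.ofFinite _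

open Classical in
/-- The interval module `V_I` as a functor from the poset `P` to finite-dimensional vector
spaces.  At `p` it is the space of functions to `k` from the one-point type (if `p ∈ I`) or the
empty type (if `p ∉ I`), so a copy of `k` or `0`; the structure map along `p ≤ q` is the identity
of `k` when `p, q ∈ I`, and zero otherwise. -/
noncomputable def intervalModule (k : Type u) [Field k] {P : Type*} [PartialOrder P]
    (I : PosetInterval P) : P ⥤ FGModuleCat.{u} k where
  obj p := FGModuleCat.of k (PLift (p ∈ I.1) → k)
  map {p q} _ := FGModuleCat.ofHom
    { toFun := fun φ _ => if h : p ∈ I.1 then φ ⟨h⟩ else 0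
      map_add' := by
        intro φ ψ; funext _; by_cases h : p ∈ I.1 <;> simp [h]
      map_smul' := by
        intro c φ; funext _; by_cases h : p ∈ I.1 <;> simp [h] }
  map_id p := by
    refine ConcreteCategory.hom_ext _ _ fun φ => ?_
    funext h
    change (if h : p ∈ I.1 then φ ⟨h⟩ else 0) = φ h
    rw [dif_pos h.down]
  map_comp {p q s} f g := by
    refine ConcreteCategory.hom_ext _ _ fun φ => ?_
    funext hs
    change (if h : p ∈ I.1 then φ ⟨h⟩ else 0) =
      (if _h : q ∈ I.1 then (if h : p ∈ I.1 then φ ⟨h⟩ else 0) else 0)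
    by_cases hq : q ∈ I.1
    · rw [dif_pos hq]
    · have hp : p ∉ I.1 := fun hp => hq (I.2.2.out hp hs.down ⟨leOfHom f, leOfHom g⟩)
      rw [dif_neg hq, dif_neg hp]

/-! ### Approximations and interval resolutions -/

/-- `f : X ⟶ M` is a right approximation of `M` by the full subcategory given by `S`. -/
def IsRightApproximation {C : Type*} [Category* C] (S : ObjectProperty C) {X M : C}
    (f : X ⟶ M) : Prop :=
  S X ∧ ∀ ⦃Y : C⦄, S Y → ∀ g : Y ⟶ M, ∃ h : Y ⟶ X, h ≫ f = g

/-- The interval-decomposable modules: finite (possibly empty) direct sums of interval modules. -/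
def intervalDecomposable (k : Type u) [Field k] (P : Type*) [PartialOrder P] :
    ObjectProperty (P ⥤ FGModuleCat.{u} k) :=
  fun X => ∃ (ι : Type) (_ : Finite ι) (J : ι → PosetInterval P),
    Nonempty (X ≅ ⨁ fun t => intervalModule k (J t))

/-- The module `⨁_J V_J ^ (d J)`. -/
noncomputable def intervalSum (k : Type u) [Field k] {P : Type*} [PartialOrder P] [Finite P]
    (d : PosetInterval P → ℕ) : P ⥤ FGModuleCat.{u} k :=
  ⨁ fun t : (Σ J : PosetInterval P, Fin (d J)) => intervalModule k t.1

/-- An interval resolution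
`0 ⟶ X r ⟶ ⋯ ⟶ X 1 ⟶ X 0 ⟶ M ⟶ 0` of `M` with `X i = ⨁_J V_J ^ (d i J)` for all `i`:
the augmentation is a right approximation of `M` by interval-decomposable modules, and each
further map, corestricted to the kernel of the next one, is a right approximation of that kernel.
It is indexed by all natural numbers, with zero terms in degrees above `r`. -/
structure IntervalResolution {k : Type u} [Field k] {P : Type*} [PartialOrder P] [Finite P]
    (M : P ⥤ FGModuleCat.{u} k) (r : ℕ) (d : ℕ → PosetInterval P → ℕ) where
  /-- the map `X 0 ⟶ M` -/
  aug : intervalSum k (d 0) ⟶ M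
  /-- the map `X (i + 1) ⟶ X i` -/
  diff : ∀ i, intervalSum k (d (i + 1)) ⟶ intervalSum k (d i)
  diff_aug : diff 0 ≫ aug = 0
  diff_diff : ∀ i, diff (i + 1) ≫ diff i = 0
  approx_aug : IsRightApproximation (intervalDecomposable k P) aug
  approx_zero : IsRightApproximation (intervalDecomposable k P)
    (kernel.lift aug (diff 0) diff_aug)
  approx_succ : ∀ i, IsRightApproximation (intervalDecomposable k P)
    (kernel.lift (diff i) (diff (i + 1)) (diff_diff i))
  eq_zero_of_lt : ∀ i, r < i → ∀ J, d i J = 0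

/-! ### Krull–Schmidt multiplicities -/

/-- `X` is a finite direct sum of indecomposable objects of which exactly `m` are isomorphic
to `L`. -/
def HasMultiplicity {C : Type*} [Category* C] [Abelian C] (X L : C) (m : ℕ) : Prop :=
  ∃ (ι : Type) (_ : Finite ι) (Z : ι → C), (∀ t, Indecomposable (Z t)) ∧
    Nonempty (X ≅ ⨁ Z) ∧ Nat.card {t // Nonempty (Z t ≅ L)} = m

open Classical in
/-- The multiplicity `d_X(L)` of the indecomposable object `L` as a direct summand of `X`, read
off from a decomposition of `X` into indecomposable objects.  (The value is `0` if `X` has no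
finite such decomposition, which does not happen for finite-dimensional modules.) -/
noncomputable def krullSchmidtMultiplicity {C : Type*} [Category* C] [Abelian C] (X L : C) : ℕ :=
  if h : ∃ m, HasMultiplicity X L m then h.choose else 0

/-! ### The quiver `1 ⟵ 2 ⟶ 3 ⟵ 4 ⟶ 5` -/

/-- The vertices of the quiver `Q'`. -/
inductive ZigzagVertex : Type
  | v1 | v2 | v3 | v4 | v5

/-- The arrows of the quiver `Q'`. -/
inductive ZigzagArrow : ZigzagVertex → ZigzagVertex → Type
  | α1 : ZigzagArrow .v2 .v1
  | α2 : ZigzagArrow .v2 .v3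
  | α3 : ZigzagArrow .v4 .v3
  | α4 : ZigzagArrow .v4 .v5

instance : Quiver.{0} ZigzagVertex where
  Hom := ZigzagArrow

/-- The quiver morphism from `Q'` to (the category) `P` given by a diagram
`p1 ≥ p2 ≤ p3 ≥ p4 ≤ p5` in `P`. -/
def zigzagPrefunctor {P : Type*} [PartialOrder P] (p1 p2 p3 p4 p5 : P)
    (h1 : p2 ≤ p1) (h2 : p2 ≤ p3) (h3 : p4 ≤ p3) (h4 : p4 ≤ p5) : ZigzagVertex ⥤q P where
  obj
    | .v1 => p1
    | .v2 => p2
    | .v3 => p3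
    | .v4 => p4
    | .v5 => p5
  map
    | ZigzagArrow.α1 => homOfLE h1
    | ZigzagArrow.α2 => homOfLE h2
    | ZigzagArrow.α3 => homOfLE h3
    | ZigzagArrow.α4 => homOfLE h4

/-! ### The commutative ladder and the functors `F_I`, `R_I` -/

/-- The commutative ladder of length `n`, as a poset: `{1, …, n} × {1, 2}` with the product order
(with indices counted from `0`). -/
def Ladder (n : ℕ) : Type := Fin n × Fin 2

namespace Ladder

instance (n : ℕ) : PartialOrder (Ladder n) := inferInstanceAs (PartialOrder (Fin n × Fin 2))

instance (n : ℕ) : Finite (Ladder n) := inferInstanceAs (Finite (Fin n × Fin 2))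

variable {n : ℕ}

/-- The vertex `x_a` of the lower row. -/
def x (a : Fin n) : Ladder n := (a, 0)

/-- The vertex `y_a` of the upper row. -/
def y (a : Fin n) : Ladder n := (a, 1)

lemma x_le_x {a b : Fin n} (h : a ≤ b) : x a ≤ x b := Prod.mk_le_mk.2 ⟨h, le_rfl⟩

lemma y_le_y {a b : Fin n} (h : a ≤ b) : y a ≤ y b := Prod.mk_le_mk.2 ⟨h, le_rfl⟩

lemma x_le_y {a b : Fin n} (h : a ≤ b) : x a ≤ y b := Prod.mk_le_mk.2 ⟨h, Fin.zero_le _⟩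

lemma le_of_x_le_y {a b : Fin n} (h : x a ≤ y b) : a ≤ b := (Prod.mk_le_mk.1 h).1

lemma not_y_le_x (a b : Fin n) : ¬ y a ≤ x b := fun h => by
  have := (Prod.mk_le_mk.1 h).2
  simp at this

lemma eq_x_or_y (p : Ladder n) : (∃ a, p = x a) ∨ ∃ a, p = y a := by
  obtain ⟨a, c⟩ := p
  fin_cases c
  · exact Or.inl ⟨a, rfl⟩
  · exact Or.inr ⟨a, rfl⟩

open Classical in
/-- The indices `a` with `x_a ∈ I`. -/
noncomputable def lower (I : PosetInterval (Ladder n)) : Finset (Fin n) :=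
  Finset.univ.filter fun a => x a ∈ I.1

open Classical in
/-- The indices `a` with `y_a ∈ I`. -/
noncomputable def upper (I : PosetInterval (Ladder n)) : Finset (Fin n) :=
  Finset.univ.filter fun a => y a ∈ I.1

lemma mem_lower {I : PosetInterval (Ladder n)} {a : Fin n} : a ∈ lower I ↔ x a ∈ I.1 := by
  simp [lower]

lemma mem_upper {I : PosetInterval (Ladder n)} {a : Fin n} : a ∈ upper I ↔ y a ∈ I.1 := by
  simp [upper]

lemma exists_x_le_y_of_walk {S : Set (Ladder n)} {p q : S}
    (w : ((SimpleGraph.hasse (Ladder n)).induce S).Walk p q) :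
    (∃ a, p.1 = x a) → (∃ b, q.1 = y b) → ∃ a b, x a ∈ S ∧ y b ∈ S ∧ a ≤ b := by
  induction w with
  | nil =>
    rintro ⟨a, ha⟩ ⟨b, hb⟩
    exact absurd (le_of_eq (hb.symm.trans ha)) (not_y_le_x _ _)
  | @cons p v q hadj w ih =>
    rintro ⟨a, ha⟩ hq
    rcases eq_x_or_y v.1 with hv | ⟨b, hb⟩
    · exact ih hv hq
    · have hadj' : p.1 ⋖ v.1 ∨ v.1 ⋖ p.1 := by simpa using hadj
      rcases hadj' with h | h
      · exact ⟨a, b, ha ▸ p.2, hb ▸ v.2, le_of_x_le_y (by rw [← ha, ← hb]; exact h.le)⟩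
      · exact absurd (by rw [← ha, ← hb]; exact h.le) (not_y_le_x b a)

/-- If `I` meets both rows, the upper row of `I` starts no later than the lower row. -/
lemma min_upper_le_min_lower (I : PosetInterval (Ladder n)) (hl : (lower I).Nonempty)
    (hu : (upper I).Nonempty) : (upper I).min' hu ≤ (lower I).min' hl := by
  have hx := mem_lower.1 ((lower I).min'_mem hl)
  have hy := mem_upper.1 ((upper I).min'_mem hu)
  obtain ⟨w⟩ := I.2.1.preconnected ⟨_, hx⟩ ⟨_, hy⟩
  obtain ⟨a, b, ha, hb, hab⟩ := exists_x_le_y_of_walk w ⟨_, rfl⟩ ⟨_, rfl⟩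
  have hia : (lower I).min' hl ≤ a := (lower I).min'_le a (mem_lower.2 ha)
  exact (upper I).min'_le _ (mem_upper.2
    (I.2.2.out hx hb ⟨x_le_y le_rfl, y_le_y (hia.trans hab)⟩))

lemma upper_nonempty_of_lower_empty (I : PosetInterval (Ladder n))
    (hl : ¬ (lower I).Nonempty) : (upper I).Nonempty := by
  obtain ⟨⟨p, hp⟩⟩ := I.2.1.nonempty
  rcases eq_x_or_y p with ⟨a, rfl⟩ | ⟨a, rfl⟩
  · exact absurd ⟨a, mem_lower.2 hp⟩ hl
  · exact ⟨a, mem_upper.2 hp⟩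

open Classical in
/-- The quiver morphism `ξ_I`.  With `x_i, x_j` the first and last vertices of `I` in the
lower row and `y_k, y_l` those in the upper row (as far as these rows meet `I`), the vertices
`1, 2, 3, 4, 5` go to `y_l, y_k, y_i, x_i, x_j` if `I` meets both rows, to
`x_j, x_i, x_i, x_i, x_j` if it lies in the lower row, and to `y_l, y_k, y_k, y_k, y_l` if it lies
in the upper row.  Arrows go to the unique morphisms of the poset. -/
noncomputable def xi (I : PosetInterval (Ladder n)) : ZigzagVertex ⥤q Ladder n :=
  if hl : (lower I).Nonempty then
    if hu : (upper I).Nonempty then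
      zigzagPrefunctor
        (y ((upper I).max' hu)) (y ((upper I).min' hu))
        (y ((lower I).min' hl)) (x ((lower I).min' hl)) (x ((lower I).max' hl))
        (y_le_y ((upper I).min'_le_max' hu)) (y_le_y (min_upper_le_min_lower I hl hu))
        (x_le_y le_rfl) (x_le_x ((lower I).min'_le_max' hl))
    else
      zigzagPrefunctor
        (x ((lower I).max' hl)) (x ((lower I).min' hl))
        (x ((lower I).min' hl)) (x ((lower I).min' hl)) (x ((lower I).max' hl))
        (x_le_x ((lower I).min'_le_max' hl)) le_rfl
        le_rfl (x_le_x ((lower I).min'_le_max' hl))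
  else
    have hu := upper_nonempty_of_lower_empty I hl
    zigzagPrefunctor
      (y ((upper I).max' hu)) (y ((upper I).min' hu))
      (y ((upper I).min' hu)) (y ((upper I).min' hu)) (y ((upper I).max' hu))
      (y_le_y ((upper I).min'_le_max' hu)) le_rfl
      le_rfl (y_le_y ((upper I).min'_le_max' hu))

/-- The functor `F_I` from the path category of `Q'` to the ladder extending `ξ_I`. -/
noncomputable def compressionFunctor (I : PosetInterval (Ladder n)) :
    Paths ZigzagVertex ⥤ Ladder n :=
  Paths.lift (xi I)

/-- The functor `R_I`: restriction `M ↦ M ∘ F_I` along `F_I`. -/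
noncomputable def compression (k : Type u) [Field k] (I : PosetInterval (Ladder n)) :
    (Ladder n ⥤ FGModuleCat.{u} k) ⥤ (Paths ZigzagVertex ⥤ FGModuleCat.{u} k) :=
  (Functor.whiskeringLeft _ _ _).obj (compressionFunctor I)

/-- The compressed multiplicity `c_M^ξ(I)`: the multiplicity of `R_I(V_I)` in `R_I(M)`. -/
noncomputable def compressedMultiplicity {k : Type u} [Field k] (M : Ladder n ⥤ FGModuleCat.{u} k)
    (I : PosetInterval (Ladder n)) : ℕ :=
  krullSchmidtMultiplicity ((compression k I).obj M) ((compression k I).obj (intervalModule k I))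

end Ladder

/-! For a zigzag p1 ← p2 → p3 ← p4 → p5 and a module M, let W be the space of pairs in M(p2) × M(p4)
with equal image in M(p3), and let W1, W5 ⊆ W be cut out by vanishing in M(p1), resp. M(p5). The
integer `mult` is dim W/(W1 + W5). It is additive on direct sums, and it computes both sides of the
formula.

For representations of the quiver, let L = R_I(V_I), which is one-dimensional at every vertex. If
`mult` is nonzero on Z, a pair outside W1 + W5 and a functional separating its middle image from the
images of ker α1 and ker α4 give maps L → Z → L with identity composite
(`exists_retract_of_mult_ne_zero`). An indecomposable such Z is therefore L, and `mult` counts the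
summands L in every decomposition (`eq_mult_of_hasMultiplicity`); uniqueness in Krull–Schmidt is not
needed.

On V_J the value is 1 if J contains all five points and 0 otherwise. For the zigzag ξ_I this
condition means I ⊆ J.

Finally, `mult` is an alternating sum of dimensions of four spaces of pairs. When p3 is the join of
p2 and p4, such pairs are sections over a convex set, whose components are intervals, so they lift
along right approximations (`spaceMap_surjective`). Hence `mult` is additive along an interval
resolution (`mult_eq_sum_of_resolution`). -/

/-! ### Linear maps underlying functors to vector spaces -/

section LinearMaps

variable {k : Type u} [Field k] {D : Type*} [Category* D]

/-- The linear map underlying the action of a functor on a morphism. -/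
def mapLin (M : D ⥤ FGModuleCat.{u} k) {p q : D} (f : p ⟶ q) : M.obj p →ₗ[k] M.obj q :=
  (M.map f).hom.hom

/-- The linear map underlying a component of a natural transformation. -/
def appLin {M N : D ⥤ FGModuleCat.{u} k} (η : M ⟶ N) (p : D) : M.obj p →ₗ[k] N.obj p :=
  (η.app p).hom.hom

lemma mapLin_id (M : D ⥤ FGModuleCat.{u} k) (p : D) (m : M.obj p) : mapLin M (𝟙 p) m = m := by
  simp [mapLin]

lemma mapLin_comp (M : D ⥤ FGModuleCat.{u} k) {p q r : D} (f : p ⟶ q) (g : q ⟶ r) (m : M.obj p) :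
    mapLin M (f ≫ g) m = mapLin M g (mapLin M f m) := by
  simp [mapLin]

lemma appLin_mapLin {M N : D ⥤ FGModuleCat.{u} k} (η : M ⟶ N) {p q : D} (f : p ⟶ q)
    (m : M.obj p) : appLin η q (mapLin M f m) = mapLin N f (appLin η p m) := by
  have h := congrArg (fun g : M.obj p ⟶ N.obj q => g.hom.hom m) (η.naturality f)
  exact h

lemma appLin_id (M : D ⥤ FGModuleCat.{u} k) (p : D) : appLin (𝟙 M) p = LinearMap.id := rfl

lemma appLin_comp_apply {M N L : D ⥤ FGModuleCat.{u} k} (η : M ⟶ N) (θ : N ⟶ L) (p : D)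
    (m : M.obj p) : appLin (η ≫ θ) p m = appLin θ p (appLin η p m) := rfl

lemma appLin_zero {M N : D ⥤ FGModuleCat.{u} k} (p : D) : appLin (0 : M ⟶ N) p = 0 := rfl

lemma appLin_add {M N : D ⥤ FGModuleCat.{u} k} (η θ : M ⟶ N) (p : D) :
    appLin (η + θ) p = appLin η p + appLin θ p := rfl

lemma natTrans_ext_appLin {M N : D ⥤ FGModuleCat.{u} k} {η θ : M ⟶ N}
    (h : ∀ p, appLin η p = appLin θ p) : η = θ := by
  ext p : 2
  exact FGModuleCat.hom_ext (h p)

/-- The natural transformation with given linear components. -/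
def natTransOfLin {M N : D ⥤ FGModuleCat.{u} k} (η : ∀ p, M.obj p →ₗ[k] N.obj p)
    (h : ∀ ⦃p q : D⦄ (f : p ⟶ q) (m : M.obj p), η q (mapLin M f m) = mapLin N f (η p m)) :
    M ⟶ N where
  app p := ConcreteCategory.ofHom (C := FGModuleCat.{u} k) (η p)
  naturality _ _ f := FGModuleCat.hom_ext (LinearMap.ext fun m => h f m)

lemma appLin_natTransOfLin {M N : D ⥤ FGModuleCat.{u} k} (η : ∀ p, M.obj p →ₗ[k] N.obj p)
    (h : ∀ ⦃p q : D⦄ (f : p ⟶ q) (m : M.obj p), η q (mapLin M f m) = mapLin N f (η p m)) (p : D) :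
    appLin (natTransOfLin η h) p = η p := rfl

end LinearMaps

/-! ### Multiplicity spaces of zigzags -/

/-- A diagram `p1 ⟵ p2 ⟶ p3 ⟵ p4 ⟶ p5` in a category. -/
structure ZigzagDiagram (D : Type*) [Category* D] where
  /-- the target of the first arrow -/
  p1 : D
  /-- the source of the first two arrows -/
  p2 : D
  /-- the target of the two middle arrows -/
  p3 : D
  /-- the source of the last two arrows -/
  p4 : D
  /-- the target of the last arrow -/
  p5 : D
  /-- the first arrow -/
  a1 : p2 ⟶ p1
  /-- the second arrow -/
  a2 : p2 ⟶ p3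
  /-- the third arrow -/
  a3 : p4 ⟶ p3
  /-- the fourth arrow -/
  a4 : p4 ⟶ p5

namespace ZigzagDiagram

variable {k : Type u} [Field k] {D : Type*} [Category* D] (z : ZigzagDiagram D)

/-- The pairs of elements of `M` at the two sources of the zigzag that agree at the middle target,
and vanish at the first (resp. last) target if `b1` (resp. `b5`) holds. -/
def space (b1 b5 : Prop) (M : D ⥤ FGModuleCat.{u} k) : Submodule k (M.obj z.p2 × M.obj z.p4) where
  carrier := {m | mapLin M z.a2 m.1 = mapLin M z.a3 m.2 ∧ (b1 → mapLin M z.a1 m.1 = 0) ∧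
    (b5 → mapLin M z.a4 m.2 = 0)}
  add_mem' := by
    rintro m m' ⟨h, h1, h5⟩ ⟨h', h1', h5'⟩
    refine ⟨?_, fun hb => ?_, fun hb => ?_⟩
    · simp [h, h']
    · simp [h1 hb, h1' hb]
    · simp [h5 hb, h5' hb]
  zero_mem' := by simp
  smul_mem' := by
    rintro c m ⟨h, h1, h5⟩
    refine ⟨?_, fun hb => ?_, fun hb => ?_⟩
    · simp [h]
    · simp [h1 hb]
    · simp [h5 hb]

lemma mem_space {b1 b5 : Prop} {M : D ⥤ FGModuleCat.{u} k} {m : M.obj z.p2 × M.obj z.p4} :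
    m ∈ z.space b1 b5 M ↔ mapLin M z.a2 m.1 = mapLin M z.a3 m.2 ∧
      (b1 → mapLin M z.a1 m.1 = 0) ∧ (b5 → mapLin M z.a4 m.2 = 0) := Iff.rfl

/-- The map on multiplicity spaces induced by a natural transformation. -/
def spaceMap (b1 b5 : Prop) {M N : D ⥤ FGModuleCat.{u} k} (η : M ⟶ N) :
    z.space b1 b5 M →ₗ[k] z.space b1 b5 N :=
  ((appLin η z.p2).prodMap (appLin η z.p4)).restrict fun m hm => by
    obtain ⟨h, h1, h5⟩ := hm
    refine ⟨?_, fun hb => ?_, fun hb => ?_⟩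
    · simp [← appLin_mapLin, h]
    · simp [← appLin_mapLin, h1 hb]
    · simp [← appLin_mapLin, h5 hb]

lemma coe_spaceMap {b1 b5 : Prop} {M N : D ⥤ FGModuleCat.{u} k} (η : M ⟶ N)
    (m : z.space b1 b5 M) :
    (z.spaceMap b1 b5 η m : N.obj z.p2 × N.obj z.p4) =
      (appLin η z.p2 m.1.1, appLin η z.p4 m.1.2) := rfl

/-- The multiplicity spaces as a functor. -/
def spaceFunctor (b1 b5 : Prop) : (D ⥤ FGModuleCat.{u} k) ⥤ ModuleCat.{u} k where
  obj M := ModuleCat.of k (z.space b1 b5 M)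
  map η := ModuleCat.ofHom (z.spaceMap b1 b5 η)
  map_id _ := rfl
  map_comp _ _ := rfl

instance (b1 b5 : Prop) : (z.spaceFunctor (k := k) b1 b5).Additive where
  map_add := rfl

lemma finrank_space_congr (b1 b5 : Prop) {M N : D ⥤ FGModuleCat.{u} k} (e : M ≅ N) :
    Module.finrank k (z.space b1 b5 M) = Module.finrank k (z.space b1 b5 N) :=
  ((z.spaceFunctor b1 b5).mapIso e).toLinearEquiv.finrank_eq

lemma finrank_space_biproduct (b1 b5 : Prop) {ι : Type} [Fintype ι]
    (Z : ι → D ⥤ FGModuleCat.{u} k) :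
    Module.finrank k (z.space b1 b5 (⨁ Z)) =
      ∑ t, Module.finrank k (z.space b1 b5 (Z t)) := by
  have e := ((z.spaceFunctor b1 b5).mapBiproduct Z ≪≫ ModuleCat.biproductIsoPi _).toLinearEquiv
  have h : Module.finrank k ((z.spaceFunctor b1 b5).obj (⨁ Z)) =
    Module.finrank k (∀ t, (z.space b1 b5 (Z t))) := e.finrank_eq
  exact h.trans (Module.finrank_pi_fintype k)

/-- The multiplicity of the full interval module of the zigzag in `M`. -/
noncomputable def mult (M : D ⥤ FGModuleCat.{u} k) : ℤ :=
  Module.finrank k (z.space False False M) - Module.finrank k (z.space True False M) -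
    Module.finrank k (z.space False True M) + Module.finrank k (z.space True True M)

lemma mult_congr {M N : D ⥤ FGModuleCat.{u} k} (e : M ≅ N) : z.mult M = z.mult N := by
  simp only [mult, z.finrank_space_congr _ _ e]

lemma mult_biproduct {ι : Type} [Fintype ι] (Z : ι → D ⥤ FGModuleCat.{u} k) :
    z.mult (⨁ Z) = ∑ t, z.mult (Z t) := by
  simp only [mult, finrank_space_biproduct, Nat.cast_sum, Finset.sum_add_distrib,
    Finset.sum_sub_distrib]

lemma mult_of_isZero {M : D ⥤ FGModuleCat.{u} k} (hM : IsZero M) : z.mult M = 0 := by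
  have h (p : D) : Subsingleton (M.obj p) := by
    refine subsingleton_of_forall_eq 0 fun m => ?_
    rw [← LinearMap.id_apply (R := k) m, ← appLin_id, hM.eq_of_src (𝟙 M) 0, appLin_zero,
      LinearMap.zero_apply]
  have h' (b1 b5 : Prop) : Module.finrank k (z.space b1 b5 M) = 0 := by
    have : z.space b1 b5 M = ⊥ := (Submodule.eq_bot_iff _).2 fun m _ =>
      Prod.ext ((h z.p2).elim _ _) ((h z.p4).elim _ _)
    rw [this, finrank_bot]
  simp [mult, h']

lemma space_le_space {b1 b5 c1 c5 : Prop} (h1 : c1 → b1) (h5 : c5 → b5)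
    (M : D ⥤ FGModuleCat.{u} k) : z.space b1 b5 M ≤ z.space c1 c5 M :=
  fun _ hm => ⟨hm.1, hm.2.1 ∘ h1, hm.2.2 ∘ h5⟩

/-- Inclusion-exclusion: the two spaces with one vanishing condition intersect in the space with
both, so `mult` is the dimension of a quotient. -/
lemma mult_eq (M : D ⥤ FGModuleCat.{u} k) :
    z.mult M = Module.finrank k (z.space False False M) -
      Module.finrank k ↥(z.space True False M ⊔ z.space False True M) := by
  have h : z.space True False M ⊓ z.space False True M = z.space True True M := by
    ext m
    simp only [Submodule.mem_inf, mem_space]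
    tauto
  have := Submodule.finrank_sup_add_finrank_inf_eq (z.space True False M) (z.space False True M)
  rw [h] at this
  rw [mult]
  omega

lemma sup_le_space (M : D ⥤ FGModuleCat.{u} k) :
    z.space True False M ⊔ z.space False True M ≤ z.space False False M :=
  sup_le (z.space_le_space (by tauto) (by tauto) M) (z.space_le_space (by tauto) (by tauto) M)

/-- If the multiplicity is nonzero, then there are elements of `M` at the two sources whose common
image `c` at the middle target does not lie in the span of the images of the elements that vanish
at the two outer targets. -/
lemma exists_of_mult_ne_zero {M : D ⥤ FGModuleCat.{u} k} (h : z.mult M ≠ 0) :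
    ∃ a b, mapLin M z.a2 a = mapLin M z.a3 b ∧
      mapLin M z.a2 a ∉ (LinearMap.ker (mapLin M z.a1)).map (mapLin M z.a2) ⊔
        (LinearMap.ker (mapLin M z.a4)).map (mapLin M z.a3) := by
  have hne : ¬ z.space False False M ≤ z.space True False M ⊔ z.space False True M := by
    intro hle
    rw [mult_eq, le_antisymm hle (z.sup_le_space M)] at h
    simp at h
  obtain ⟨⟨a, b⟩, hm, hn⟩ := SetLike.not_le_iff_exists.1 hne
  refine ⟨a, b, hm.1, fun hc => hn ?_⟩
  obtain ⟨_, ⟨a', ha', rfl⟩, _, ⟨b', hb', rfl⟩, hab⟩ := Submodule.mem_sup.1 hc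
  simp only [SetLike.mem_coe, LinearMap.mem_ker] at ha' hb'
  have hba : mapLin M z.a3 b = mapLin M z.a2 a := hm.1.symm
  -- If the middle image is the sum of the images of a' ∈ ker a1 and b' ∈ ker a4, then (a, b) = (a',
  -- b - b') + (a - a', b'), and both pairs still agree in the middle.
  refine Submodule.mem_sup.2 ⟨(a', b - b'), ⟨?_, fun _ => ha', False.elim⟩,
    (a - a', b'), ⟨?_, False.elim, fun _ => hb'⟩, by simp⟩
  · simp [hba, ← hab]
  · simp [← hab]

end ZigzagDiagram

/-! ### Sections over convex subsets of a poset -/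

section Sections

variable {k : Type u} [Field k] {P : Type*} [PartialOrder P]

/-- A family of elements of `M` that is supported on `S` and preserved by the structure maps
starting in `S`. -/
structure IsSection (S : Set P) (M : P ⥤ FGModuleCat.{u} k) (m : ∀ p, M.obj p) : Prop where
  eq_zero : ∀ p ∉ S, m p = 0
  map_eq : ∀ ⦃p q : P⦄ (h : p ≤ q), p ∈ S → mapLin M (homOfLE h) (m p) = m q

lemma IsSection.app {S : Set P} {M N : P ⥤ FGModuleCat.{u} k} {m : ∀ p, M.obj p}
    (hm : IsSection S M m) (η : M ⟶ N) : IsSection S N fun p => appLin η p (m p) where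
  eq_zero p hp := by simp [hm.eq_zero p hp]
  map_eq p q h hp := by rw [← appLin_mapLin, hm.map_eq h hp]

/-- The family of generators of an interval module. -/
def intervalModuleOne (k : Type u) [Field k] (I : PosetInterval P) (p : P) :
    (intervalModule k I).obj p :=
  fun _ : PLift (p ∈ I.1) => (1 : k)

/-- The coordinate of an interval module at a point of the interval. -/
def intervalModuleCoord (k : Type u) [Field k] (I : PosetInterval P) {p : P} (h : p ∈ I.1) :
    (intervalModule k I).obj p →ₗ[k] k :=
  (LinearMap.proj (PLift.up h) : (PLift (p ∈ I.1) → k) →ₗ[k] k)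

lemma intervalModule_ext {I : PosetInterval P} {p : P} {φ ψ : (intervalModule k I).obj p}
    (h : ∀ hp : p ∈ I.1, intervalModuleCoord k I hp φ = intervalModuleCoord k I hp ψ) :
    φ = ψ :=
  funext fun hp : PLift (p ∈ I.1) => h hp.down

lemma intervalModuleCoord_one (I : PosetInterval P) {p : P} (h : p ∈ I.1) :
    intervalModuleCoord k I h (intervalModuleOne k I p) = 1 := rfl

lemma intervalModuleCoord_mapLin (I : PosetInterval P) {p q : P} (f : p ⟶ q) (hp : p ∈ I.1)
    (hq : q ∈ I.1) (φ : (intervalModule k I).obj p) :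
    intervalModuleCoord k I hq (mapLin (intervalModule k I) f φ) =
      intervalModuleCoord k I hp φ :=
  dif_pos hp

lemma intervalModule_eq_smul_one {I : PosetInterval P} {p : P} (hp : p ∈ I.1)
    (φ : (intervalModule k I).obj p) :
    φ = intervalModuleCoord k I hp φ • intervalModuleOne k I p :=
  intervalModule_ext fun _ => by rw [map_smul, intervalModuleCoord_one, smul_eq_mul, mul_one]

lemma intervalModule_eq_zero {I : PosetInterval P} {p : P} (hp : p ∉ I.1)
    (φ : (intervalModule k I).obj p) : φ = 0 :=
  intervalModule_ext fun h => absurd h hp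

/-- This is the universal section: with `IsSection.hom`, it identifies morphisms out of V_I with
sections over I. -/
lemma isSection_intervalModuleOne (I : PosetInterval P) :
    IsSection I.1 (intervalModule k I) (intervalModuleOne k I) where
  eq_zero _ hp := intervalModule_eq_zero hp _
  map_eq p q h hp := intervalModule_ext fun hq => by
    rw [intervalModuleCoord_mapLin I _ hp hq, intervalModuleCoord_one, intervalModuleCoord_one]

open Classical in
/-- The morphism from an interval module defined by a section over the interval. -/
noncomputable def IsSection.hom {I : PosetInterval P} {M : P ⥤ FGModuleCat.{u} k}
    {m : ∀ p, M.obj p} (hm : IsSection I.1 M m) : intervalModule k I ⟶ M :=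
  natTransOfLin
    (fun p => if h : p ∈ I.1 then
      LinearMap.toSpanSingleton k (M.obj p) (m p) ∘ₗ intervalModuleCoord k I h else 0)
    (fun p q f φ => by
      by_cases hp : p ∈ I.1
      · have hpq : mapLin M f (m p) = m q := hm.map_eq (leOfHom f) hp
        rw [dif_pos hp, LinearMap.comp_apply, LinearMap.toSpanSingleton_apply, map_smul, hpq]
        by_cases hq : q ∈ I.1
        · rw [dif_pos hq, LinearMap.comp_apply, LinearMap.toSpanSingleton_apply,
            intervalModuleCoord_mapLin I f hp hq]
        · rw [dif_neg hq, hm.eq_zero q hq, smul_zero, LinearMap.zero_apply]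
      · simp [intervalModule_eq_zero hp φ])

lemma IsSection.appLin_hom_one {I : PosetInterval P} {M : P ⥤ FGModuleCat.{u} k}
    {m : ∀ p, M.obj p} (hm : IsSection I.1 M m) (p : P) :
    appLin hm.hom p (intervalModuleOne k I p) = m p := by
  rw [IsSection.hom, appLin_natTransOfLin]
  by_cases hp : p ∈ I.1
  · rw [dif_pos hp, LinearMap.comp_apply, LinearMap.toSpanSingleton_apply,
      intervalModuleCoord_one, one_smul]
  · rw [dif_neg hp, hm.eq_zero p hp, LinearMap.zero_apply]

lemma intervalModule_hom_ext {I : PosetInterval P} {M : P ⥤ FGModuleCat.{u} k}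
    {η θ : intervalModule k I ⟶ M}
    (h : ∀ p, appLin η p (intervalModuleOne k I p) = appLin θ p (intervalModuleOne k I p)) :
    η = θ := by
  refine natTrans_ext_appLin fun p => LinearMap.ext fun φ => ?_
  by_cases hp : p ∈ I.1
  · rw [intervalModule_eq_smul_one hp φ, map_smul, map_smul, h]
  · rw [intervalModule_eq_zero hp φ, map_zero, map_zero]

lemma intervalDecomposable_intervalModule (I : PosetInterval P) :
    intervalDecomposable k P (intervalModule k I) :=
  ⟨Unit, inferInstance, fun _ => I, ⟨(biproductUniqueIso fun _ : Unit => intervalModule k I).symm⟩⟩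

/-- Sections over intervals lift along right approximations by interval-decomposable modules. -/
lemma IsSection.exists_lift_of_interval {I : PosetInterval P} {X N : P ⥤ FGModuleCat.{u} k}
    {f : X ⟶ N} (hf : IsRightApproximation (intervalDecomposable k P) f) {m : ∀ p, N.obj p}
    (hm : IsSection I.1 N m) : ∃ m', IsSection I.1 X m' ∧ ∀ p, appLin f p (m' p) = m p := by
  obtain ⟨g, hg⟩ := hf.2 (intervalDecomposable_intervalModule I) hm.hom
  refine ⟨_, (isSection_intervalModuleOne I).app g, fun p => ?_⟩
  rw [← appLin_comp_apply, hg, hm.appLin_hom_one]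

/-- Finiteness refines p ≤ q to a chain of covers, and convexity keeps the chain inside S. -/
lemma reachable_of_le [Finite P] {S : Set P} (hS : S.OrdConnected) {p q : P} (hp : p ∈ S)
    (hq : q ∈ S) (h : p ≤ q) :
    ((SimpleGraph.hasse P).induce S).Reachable ⟨p, hp⟩ ⟨q, hq⟩ := by
  classical
  have := Fintype.ofFinite P
  let _ : LocallyFiniteOrder P := Fintype.toLocallyFiniteOrder
  have h' := le_iff_reflTransGen_covBy.1 h
  clear h
  induction h' with
  | refl => exact SimpleGraph.Reachable.refl _
  | @tail a b hpa hab ih =>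
    have ha : a ∈ S := hS.out hp hq ⟨le_iff_reflTransGen_covBy.2 hpa, hab.le⟩
    refine (ih ha).trans (SimpleGraph.Adj.reachable ?_)
    simpa using Or.inl hab

/-- The connected component of a point in a convex subset of a finite poset is an interval. -/
lemma isPosetInterval_component [Finite P] {S : Set P} (hS : S.OrdConnected)
    (c : ((SimpleGraph.hasse P).induce S).ConnectedComponent) :
    IsPosetInterval (Subtype.val '' c.supp : Set P) := by
  refine ⟨?_, ⟨?_⟩⟩
  · refine SimpleGraph.Connected.map (G := ((SimpleGraph.hasse P).induce S).induce c.supp)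
      ⟨fun p => ⟨p.1.1, p.1, p.2, rfl⟩, fun h => h⟩ ?_ c.connected_toSimpleGraph
    rintro ⟨_, p, hp, rfl⟩
    exact ⟨⟨p, hp⟩, rfl⟩
  -- A point between two points of the component lies in S by convexity, and is then joined to the
  -- lower one inside S.
  · rintro _ ⟨⟨p, hp⟩, hpc, rfl⟩ _ ⟨⟨q, hq⟩, hqc, rfl⟩ r ⟨hpr, hrq⟩
    have hr := hS.out hp hq ⟨hpr, hrq⟩
    refine ⟨⟨r, hr⟩, ?_, rfl⟩
    rw [SimpleGraph.ConnectedComponent.mem_supp_iff] at hpc ⊢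
    rw [← hpc]
    exact (SimpleGraph.ConnectedComponent.sound (reachable_of_le hS hp hr hpr)).symm

open Classical in
/-- Sections over convex subsets lift along right approximations by interval-decomposable
modules. -/
lemma IsSection.exists_lift [Finite P] {S : Set P} (hS : S.OrdConnected)
    {X N : P ⥤ FGModuleCat.{u} k} {f : X ⟶ N}
    (hf : IsRightApproximation (intervalDecomposable k P) f) {m : ∀ p, N.obj p}
    (hm : IsSection S N m) : ∃ m', IsSection S X m' ∧ ∀ p, appLin f p (m' p) = m p := by
  let G := (SimpleGraph.hasse P).induce S
  let C : G.ConnectedComponent → PosetInterval P :=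
    fun c => ⟨Subtype.val '' c.supp, isPosetInterval_component hS c⟩
  have mem_C (p : P) (hp : p ∈ S) (c) : p ∈ (C c).1 ↔ G.connectedComponentMk ⟨p, hp⟩ = c := by
    constructor
    · rintro ⟨p, hpc, rfl⟩
      exact hpc
    · exact fun h => ⟨⟨p, hp⟩, h, rfl⟩
  have C_sub (c) : (C c).1 ⊆ S := by
    rintro _ ⟨p, _, rfl⟩
    exact p.2
  have same {p q : P} (hp : p ∈ S) (hq : q ∈ S) (h : p ≤ q) :
      G.connectedComponentMk ⟨p, hp⟩ = G.connectedComponentMk ⟨q, hq⟩ :=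
    SimpleGraph.ConnectedComponent.sound (reachable_of_le hS hp hq h)
  -- Comparable points of S share a component, so a structure map that leaves the component also
  -- leaves S, where the section is zero.
  have restrict (c) : IsSection (C c).1 N fun p => if p ∈ (C c).1 then m p else 0 := by
    refine ⟨fun p hp => if_neg hp, fun p q h hp => ?_⟩
    have hpS := C_sub c hp
    rw [if_pos hp, hm.map_eq h hpS]
    by_cases hq : q ∈ S
    · rw [if_pos ((mem_C q hq c).2 ((same hpS hq h).symm.trans ((mem_C p hpS c).1 hp)))]
    · rw [if_neg fun h => hq (C_sub c h), hm.eq_zero q hq]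
  choose m' hm' hfm using fun c => (restrict c).exists_lift_of_interval hf
  -- Glue the lifts: at p, use the lift belonging to the component of p.
  refine ⟨fun p => if hp : p ∈ S then m' (G.connectedComponentMk ⟨p, hp⟩) p else 0,
    ⟨fun p hp => dif_neg hp, fun p q h hp => ?_⟩, fun p => ?_⟩
  · simp only [dif_pos hp]
    rw [(hm' _).map_eq h ((mem_C p hp _).2 rfl)]
    by_cases hq : q ∈ S
    · rw [dif_pos hq, same hp hq h]
    · rw [dif_neg hq, (hm' _).eq_zero q fun h => hq (C_sub _ h)]
  · by_cases hp : p ∈ S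
    · simp only [dif_pos hp]
      rw [hfm, if_pos ((mem_C p hp _).2 rfl)]
    · simp only [dif_neg hp, map_zero, hm.eq_zero p hp]

end Sections

/-! ### Exactness of evaluation -/

section Exact

variable {k : Type u} [Field k] {P : Type*} [PartialOrder P]

/-- Every element of `M` at `p` comes from a morphism out of the interval module of the principal
upper set of `p`. -/
lemma exists_hom_of_element [Finite P] {M : P ⥤ FGModuleCat.{u} k} {p : P} (m : M.obj p) :
    ∃ (I : PosetInterval P) (g : intervalModule k I ⟶ M),
      appLin g p (intervalModuleOne k I p) = m ∧
        ∀ {N : P ⥤ FGModuleCat.{u} k} (f : M ⟶ N), appLin f p m = 0 → g ≫ f = 0 := by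
  classical
  have hI : IsPosetInterval (Set.Ici p) := by
    refine ⟨?_, Set.ordConnected_Ici⟩
    have : Nonempty (Set.Ici p) := ⟨⟨p, le_rfl⟩⟩
    refine ⟨fun a b => ?_⟩
    exact (reachable_of_le Set.ordConnected_Ici (Set.mem_Ici.2 le_rfl) a.2 a.2).symm.trans
      (reachable_of_le Set.ordConnected_Ici (Set.mem_Ici.2 le_rfl) b.2 b.2)
  have hs : IsSection (Set.Ici p) M fun q => if h : p ≤ q then mapLin M (homOfLE h) m else 0 := by
    refine ⟨fun q hq => dif_neg hq, fun q r h hq => ?_⟩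
    have hq : p ≤ q := hq
    rw [dif_pos hq, dif_pos (hq.trans h), ← mapLin_comp]
    rfl
  refine ⟨⟨_, hI⟩, IsSection.hom (I := ⟨_, hI⟩) hs, ?_, fun {N} f hf => ?_⟩
  · rw [IsSection.appLin_hom_one]
    exact (dif_pos le_rfl).trans (mapLin_id M p m)
  · refine intervalModule_hom_ext fun q => ?_
    rw [appLin_comp_apply, IsSection.appLin_hom_one, appLin_zero, LinearMap.zero_apply]
    by_cases h : p ≤ q
    · rw [dif_pos h, appLin_mapLin, hf, map_zero]
    · rw [dif_neg h, map_zero]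

/-- An element killed by f defines a morphism from the interval module of an upper set that f kills;
since f is mono, that morphism is zero. -/
lemma appLin_injective [Finite P] {M N : P ⥤ FGModuleCat.{u} k} (f : M ⟶ N) [Mono f] (p : P) :
    Function.Injective (appLin f p) := by
  rw [injective_iff_map_eq_zero]
  intro m hm
  obtain ⟨I, g, rfl, hg⟩ := exists_hom_of_element m
  rw [zero_of_comp_mono f (hg f hm), appLin_zero, LinearMap.zero_apply]

lemma exists_appLin_kernel_ι [Finite P] {M N : P ⥤ FGModuleCat.{u} k} (f : M ⟶ N) {p : P}
    {m : M.obj p} (hm : appLin f p m = 0) : ∃ m', appLin (kernel.ι f) p m' = m := by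
  obtain ⟨I, g, rfl, hg⟩ := exists_hom_of_element m
  exact ⟨appLin (kernel.lift f g (hg f hm)) p (intervalModuleOne k I p), by
    rw [← appLin_comp_apply, kernel.lift_ι]⟩

/-! ### Exactness of multiplicity spaces along right approximations -/

namespace ZigzagDiagram

variable (z : ZigzagDiagram P)

lemma spaceMap_injective [Finite P] (b1 b5 : Prop) {M N : P ⥤ FGModuleCat.{u} k} (f : M ⟶ N)
    [Mono f] : Function.Injective (z.spaceMap b1 b5 f) := by
  intro m m' h
  have h' := congrArg Subtype.val h
  simp only [coe_spaceMap, Prod.mk.injEq] at h'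
  exact Subtype.ext (Prod.ext (appLin_injective f _ h'.1) (appLin_injective f _ h'.2))

/-- Left exactness: the defining equations of a pair can be checked after the pointwise injective
inclusion of the kernel. -/
lemma range_spaceMap_kernel_ι [Finite P] (b1 b5 : Prop) {M N : P ⥤ FGModuleCat.{u} k}
    (f : M ⟶ N) :
    LinearMap.range (z.spaceMap b1 b5 (kernel.ι f)) = LinearMap.ker (z.spaceMap b1 b5 f) := by
  refine le_antisymm ?_ ?_
  · rintro _ ⟨m, rfl⟩
    refine LinearMap.mem_ker.2 (Subtype.ext (Prod.ext ?_ ?_)) <;>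
    · simp only [coe_spaceMap]
      rw [← appLin_comp_apply, kernel.condition]
      rfl
  · rintro ⟨⟨a, b⟩, h, h1, h5⟩ hm
    have hm' := congrArg Subtype.val (LinearMap.mem_ker.1 hm)
    simp only [coe_spaceMap, ZeroMemClass.coe_zero, Prod.mk_eq_zero] at hm'
    obtain ⟨a, rfl⟩ := exists_appLin_kernel_ι f hm'.1
    obtain ⟨b, rfl⟩ := exists_appLin_kernel_ι f hm'.2
    simp only [← appLin_mapLin] at h h1 h5
    have inj := fun p => appLin_injective (kernel.ι f) p
    refine ⟨⟨(a, b), inj _ h, fun hb => inj _ ((h1 hb).trans (map_zero _).symm),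
      fun hb => inj _ ((h5 hb).trans (map_zero _).symm)⟩, rfl⟩

open Classical in
-- A pair spreads to a section over U \ D, where U is the upper set generated by p2 and p4, and D
-- the one generated by those of p1, p5 at which vanishing is imposed. Sections over this convex set
-- lift, and the lift is read off at p2 and p4. By `hz`, p3 is the join of p2 and p4, so agreement
-- at p3 gives agreement wherever both elements propagate.
lemma spaceMap_surjective [Finite P] (hz : ∀ q, z.p2 ≤ q → z.p4 ≤ q → z.p3 ≤ q) (b1 b5 : Prop)
    {X N : P ⥤ FGModuleCat.{u} k} {f : X ⟶ N}
    (hf : IsRightApproximation (intervalDecomposable k P) f) :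
    Function.Surjective (z.spaceMap b1 b5 f) := by
  rintro ⟨⟨a, b⟩, h, h1, h5⟩
  dsimp only at h h1 h5
  have agree {q : P} (h2 : z.p2 ≤ q) (h4 : z.p4 ≤ q) :
      mapLin N (homOfLE h2) a = mapLin N (homOfLE h4) b := by
    have h3 := hz q h2 h4
    have ha : homOfLE h2 = z.a2 ≫ homOfLE h3 := rfl
    have hb : homOfLE h4 = z.a3 ≫ homOfLE h3 := rfl
    rw [ha, hb, mapLin_comp, mapLin_comp, h]
  let D : Set P := {q | (b1 ∧ z.p1 ≤ q) ∨ (b5 ∧ z.p5 ≤ q)}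
  have hD {q r : P} (hqr : q ≤ r) (hq : q ∈ D) : r ∈ D :=
    hq.imp (fun hq => ⟨hq.1, hq.2.trans hqr⟩) (fun hq => ⟨hq.1, hq.2.trans hqr⟩)
  let U : Set P := {q | z.p2 ≤ q ∨ z.p4 ≤ q}
  have hU {q r : P} (hqr : q ≤ r) (hq : q ∈ U) : r ∈ U :=
    hq.imp (fun hq => hq.trans hqr) (fun hq => hq.trans hqr)
  have a_zero {q : P} (hq : q ∈ D) (h2 : z.p2 ≤ q) : mapLin N (homOfLE h2) a = 0 := by
    rcases hq with ⟨hb, hq⟩ | ⟨hb, hq⟩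
    · have ha : homOfLE h2 = z.a1 ≫ homOfLE hq := rfl
      rw [ha, mapLin_comp, h1 hb, map_zero]
    -- Above p5 the point also lies above p4, so a may be replaced by b there.
    · have hb' : homOfLE ((leOfHom z.a4).trans hq) = z.a4 ≫ homOfLE hq := rfl
      rw [agree h2 ((leOfHom z.a4).trans hq), hb', mapLin_comp, h5 hb, map_zero]
  have b_zero {q : P} (hq : q ∈ D) (h4 : z.p4 ≤ q) : mapLin N (homOfLE h4) b = 0 := by
    rcases hq with ⟨hb, hq⟩ | ⟨hb, hq⟩
    · rw [← agree ((leOfHom z.a1).trans hq) h4]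
      exact a_zero (Or.inl ⟨hb, hq⟩) _
    · have hb' : homOfLE h4 = z.a4 ≫ homOfLE hq := rfl
      rw [hb', mapLin_comp, h5 hb, map_zero]
  let m : ∀ q, N.obj q := fun q => if h2 : z.p2 ≤ q then mapLin N (homOfLE h2) a else
    if h4 : z.p4 ≤ q then mapLin N (homOfLE h4) b else 0
  have m2 {q : P} (h2 : z.p2 ≤ q) : m q = mapLin N (homOfLE h2) a := dif_pos h2
  have m4 {q : P} (h4 : z.p4 ≤ q) : m q = mapLin N (homOfLE h4) b := by
    by_cases h2 : z.p2 ≤ q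
    · rw [m2 h2, agree h2 h4]
    · exact (dif_neg h2).trans (dif_pos h4)
  have hS : (U \ D).OrdConnected :=
    ⟨fun p hp q hq r hr => ⟨hU hr.1 hp.1, fun h => hq.2 (hD hr.2 h)⟩⟩
  have hm : IsSection (U \ D) N m := by
    refine ⟨fun p hp => ?_, fun p q hpq hp => ?_⟩
    · by_cases h2 : z.p2 ≤ p
      · rw [m2 h2, a_zero (by_contra fun h => hp ⟨Or.inl h2, h⟩)]
      · by_cases h4 : z.p4 ≤ p
        · rw [m4 h4, b_zero (by_contra fun h => hp ⟨Or.inr h4, h⟩)]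
        · exact (dif_neg h2).trans (dif_neg h4)
    · rcases hp.1 with h2 | h4
      · rw [m2 h2, m2 (h2.trans hpq), ← mapLin_comp]
        rfl
      · rw [m4 h4, m4 (h4.trans hpq), ← mapLin_comp]
        rfl
  obtain ⟨m', hm', hfm⟩ := hm.exists_lift hS hf
  have m'_zero {q : P} (hq : q ∈ D) : m' q = 0 := hm'.eq_zero q fun h => h.2 hq
  -- The section property covers maps starting in U \ D; maps starting in D stay in D, where m'
  -- vanishes.
  have m'_map {p q : P} (g : p ⟶ q) (hp : p ∈ U) : mapLin X g (m' p) = m' q := by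
    by_cases hpD : p ∈ D
    · rw [m'_zero hpD, m'_zero (hD (leOfHom g) hpD), map_zero]
    · exact hm'.map_eq (leOfHom g) ⟨hp, hpD⟩
  refine ⟨⟨(m' z.p2, m' z.p4), ?_, fun hb => ?_, fun hb => ?_⟩, Subtype.ext (Prod.ext ?_ ?_)⟩
  · dsimp only
    rw [m'_map z.a2 (Or.inl le_rfl), m'_map z.a3 (Or.inr le_rfl)]
  · exact (m'_map z.a1 (Or.inl le_rfl)).trans (m'_zero (Or.inl ⟨hb, le_rfl⟩))
  · exact (m'_map z.a4 (Or.inr le_rfl)).trans (m'_zero (Or.inr ⟨hb, le_rfl⟩))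
  · exact ((hfm _).trans (m2 le_rfl)).trans (mapLin_id N _ a)
  · exact ((hfm _).trans (m4 le_rfl)).trans (mapLin_id N _ b)

lemma finrank_space_of_rightApproximation [Finite P]
    (hz : ∀ q, z.p2 ≤ q → z.p4 ≤ q → z.p3 ≤ q) (b1 b5 : Prop)
    {X N : P ⥤ FGModuleCat.{u} k} {f : X ⟶ N}
    (hf : IsRightApproximation (intervalDecomposable k P) f) :
    Module.finrank k (z.space b1 b5 X) =
      Module.finrank k (z.space b1 b5 N) + Module.finrank k (z.space b1 b5 (kernel f)) := by
  rw [← LinearMap.finrank_range_add_finrank_ker (z.spaceMap b1 b5 f),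
    LinearMap.range_eq_top.2 (z.spaceMap_surjective hz b1 b5 hf), finrank_top,
    ← range_spaceMap_kernel_ι, LinearMap.finrank_range_of_inj (z.spaceMap_injective b1 b5 _)]

lemma mult_of_rightApproximation [Finite P] (hz : ∀ q, z.p2 ≤ q → z.p4 ≤ q → z.p3 ≤ q)
    {X N : P ⥤ FGModuleCat.{u} k} {f : X ⟶ N}
    (hf : IsRightApproximation (intervalDecomposable k P) f) :
    z.mult X = z.mult N + z.mult (kernel f) := by
  simp only [mult, z.finrank_space_of_rightApproximation hz _ _ hf, Nat.cast_add]
  ring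

lemma isZero_intervalSum [Finite P] {e : PosetInterval P → ℕ} (he : ∀ J, e J = 0) :
    IsZero (intervalSum k e) := by
  have : IsEmpty (Σ J : PosetInterval P, Fin (e J)) := ⟨fun t => by
    have := t.2.2
    simp [he] at this⟩
  exact (IsZero.iff_id_eq_zero _).2 (biproduct.hom_ext _ _ isEmptyElim)

/-- The multiplicity is the alternating sum of the multiplicities in the terms of an interval
resolution. -/
lemma mult_eq_sum_of_resolution [Finite P] (hz : ∀ q, z.p2 ≤ q → z.p4 ≤ q → z.p3 ≤ q)
    {M : P ⥤ FGModuleCat.{u} k} {r : ℕ} {d : ℕ → PosetInterval P → ℕ}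
    (res : IntervalResolution M r d) :
    z.mult M = ∑ i ∈ Finset.range (r + 1), (-1 : ℤ) ^ i * z.mult (intervalSum k (d i)) := by
  -- The approximation of ker (diff i) has the same kernel as diff (i + 1), since the inclusion of
  -- ker (diff i) is mono.
  have step (i : ℕ) : z.mult (intervalSum k (d (i + 2))) =
      z.mult (kernel (res.diff i)) + z.mult (kernel (res.diff (i + 1))) := by
    rw [z.mult_of_rightApproximation hz (res.approx_succ i), add_right_inj,
      ← z.mult_congr (kernelCompMono _ (kernel.ι (res.diff i)))]
    exact z.mult_congr (kernelIsoOfEq (kernel.lift_ι _ _ _))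
  have step_zero : z.mult (intervalSum k (d 1)) =
      z.mult (kernel res.aug) + z.mult (kernel (res.diff 0)) := by
    rw [z.mult_of_rightApproximation hz res.approx_zero, add_right_inj,
      ← z.mult_congr (kernelCompMono _ (kernel.ι res.aug))]
    exact z.mult_congr (kernelIsoOfEq (kernel.lift_ι _ _ _))
  -- Telescoping: truncating after degree i + 1 leaves the kernel of diff i as error term.
  have partial_sum (i : ℕ) : z.mult M =
      ∑ j ∈ Finset.range (i + 2), (-1 : ℤ) ^ j * z.mult (intervalSum k (d j)) +
        (-1) ^ i * z.mult (kernel (res.diff i)) := by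
    induction i with
    | zero =>
      have := z.mult_of_rightApproximation hz res.approx_aug
      simp only [zero_add, Finset.sum_range_succ, Finset.sum_range_zero, pow_zero, pow_one]
      linarith
    | succ i ih =>
      rw [ih, Finset.sum_range_succ _ (i + 2), step i]
      ring
  -- The term in degree r + 1 is zero, hence so is its subobject ker (diff r); both surplus
  -- contributions disappear.
  have hzero : IsZero (intervalSum k (d (r + 1))) := isZero_intervalSum
    (res.eq_zero_of_lt (r + 1) (Nat.lt_succ_self r))
  rw [partial_sum r, Finset.sum_range_succ _ (r + 1), z.mult_of_isZero hzero,
    z.mult_of_isZero (hzero.of_mono (kernel.ι (res.diff r)))]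
  ring

/-! ### Multiplicities of interval modules -/

lemma mult_intervalSum {Q : Type} [PartialOrder Q] [Finite Q] (z : ZigzagDiagram Q)
    (e : PosetInterval Q → ℕ) :
    z.mult (intervalSum k e) = ∑ J, (e J : ℤ) * z.mult (intervalModule k J) := by
  rw [intervalSum, mult_biproduct, Fintype.sum_sigma]
  simp

/-- A compatible pair is a single scalar, carried unchanged to both ends; vanishing at either end
kills it. -/
lemma mult_intervalModule_of_mem (J : PosetInterval P) (h1 : z.p1 ∈ J.1) (h2 : z.p2 ∈ J.1)
    (h3 : z.p3 ∈ J.1) (h4 : z.p4 ∈ J.1) (h5 : z.p5 ∈ J.1) :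
    z.mult (intervalModule k J) = 1 := by
  have hone := isSection_intervalModuleOne (k := k) J
  have coord_eq {m : (intervalModule k J).obj z.p2 × (intervalModule k J).obj z.p4}
      (hm : m ∈ z.space False False (intervalModule k J)) :
      intervalModuleCoord k J h2 m.1 = intervalModuleCoord k J h4 m.2 := by
    have := congrArg (intervalModuleCoord k J h3) hm.1
    rwa [intervalModuleCoord_mapLin J _ h2 h3, intervalModuleCoord_mapLin J _ h4 h3] at this
  have ext_zero {m : (intervalModule k J).obj z.p2 × (intervalModule k J).obj z.p4}
      (hm : m ∈ z.space False False (intervalModule k J))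
      (h : intervalModuleCoord k J h2 m.1 = 0) : m = 0 := by
    refine Prod.ext (intervalModule_ext fun _ => ?_) (intervalModule_ext fun _ => ?_)
    · exact h.trans (map_zero _).symm
    · exact ((coord_eq hm).symm.trans h).trans (map_zero _).symm
  have space1 : z.space True False (intervalModule k J) = ⊥ := by
    refine (Submodule.eq_bot_iff _).2 fun m hm => ?_
    refine ext_zero (z.space_le_space (by tauto) (by tauto) _ hm) ?_
    rw [← intervalModuleCoord_mapLin J z.a1 h2 h1, hm.2.1 trivial, map_zero]
  have space5 : z.space False True (intervalModule k J) = ⊥ := by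
    refine (Submodule.eq_bot_iff _).2 fun m hm => ?_
    have hm' := z.space_le_space (c1 := False) (c5 := False) (by tauto) (by tauto) _ hm
    refine ext_zero hm' ?_
    rw [coord_eq hm', ← intervalModuleCoord_mapLin J z.a4 h4 h5, hm.2.2 trivial, map_zero]
  have space0 : Module.finrank k (z.space False False (intervalModule k J)) = 1 := by
    refine finrank_eq_one_iff'.2 ⟨⟨(intervalModuleOne k J _, intervalModuleOne k J _),
      ?_, False.elim, False.elim⟩, fun h => ?_, fun m => ⟨intervalModuleCoord k J h2 m.1.1, ?_⟩⟩
    · exact (hone.map_eq _ h2).trans (hone.map_eq _ h4).symm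
    · have := congrArg (fun m => intervalModuleCoord k J h2 m.1.1) h
      exact one_ne_zero this
    · refine Subtype.ext (Prod.ext ?_ ?_)
      · exact (intervalModule_eq_smul_one h2 _).symm
      · change intervalModuleCoord k J h2 m.1.1 • intervalModuleOne k J z.p4 = m.1.2
        rw [coord_eq m.2]
        exact (intervalModule_eq_smul_one h4 _).symm
  rw [mult_eq, space1, space5, space0]
  simp

/-- If p2, p3 or p4 is missing, the common middle image is zero; if p1 or p5 is missing, that image
comes from the kernel of the corresponding outer map. Either way it lies in the excluded span. -/
lemma mem_of_mult_intervalModule_ne_zero {J : PosetInterval P}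
    (h : z.mult (intervalModule k J) ≠ 0) :
    z.p1 ∈ J.1 ∧ z.p2 ∈ J.1 ∧ z.p3 ∈ J.1 ∧ z.p4 ∈ J.1 ∧ z.p5 ∈ J.1 := by
  obtain ⟨a, b, hab, hn⟩ := z.exists_of_mult_ne_zero h
  refine ⟨?_, ?_, ?_, ?_, ?_⟩ <;> refine by_contra fun hp => hn ?_
  · exact Submodule.mem_sup_left ⟨a, intervalModule_eq_zero hp _, rfl⟩
  · rw [intervalModule_eq_zero hp a, map_zero]
    exact zero_mem _
  · rw [intervalModule_eq_zero hp (mapLin _ z.a2 a)]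
    exact zero_mem _
  · rw [hab, intervalModule_eq_zero hp b, map_zero]
    exact zero_mem _
  · rw [hab]
    exact Submodule.mem_sup_right ⟨b, intervalModule_eq_zero hp _, rfl⟩

end ZigzagDiagram

end Exact

/-! ### Existence of decompositions into indecomposables -/

section Decomposition

variable {C : Type*} [Category* C] [Abelian C]

/-- The biproduct over a sum of index types. -/
noncomputable def biproductSumIso {ι κ : Type} [Finite ι] [Finite κ] (V : ι ⊕ κ → C) :
    (⨁ fun i => V (Sum.inl i)) ⊞ (⨁ fun i => V (Sum.inr i)) ≅ ⨁ V where
  hom := biprod.desc (biproduct.desc fun i => biproduct.ι V (Sum.inl i))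
    (biproduct.desc fun i => biproduct.ι V (Sum.inr i))
  inv := biproduct.desc (Sum.rec
    (fun i => biproduct.ι (fun i => V (Sum.inl i)) i ≫ biprod.inl)
    (fun i => biproduct.ι (fun i => V (Sum.inr i)) i ≫ biprod.inr))
  hom_inv_id := by
    ext i : 2 <;> simp
  inv_hom_id := by
    refine biproduct.hom_ext' _ _ fun t => ?_
    rcases t with i | i <;> simp

/-- If `L` is a nonzero retract of an indecomposable object, then it is isomorphic to it. -/
lemma nonempty_iso_of_retract {L Z : C} (hZ : Indecomposable Z) (hL : ¬ IsZero L) (i : L ⟶ Z)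
    (r : Z ⟶ L) (h : i ≫ r = 𝟙 L) : Nonempty (Z ≅ L) := by
  have : Mono i := mono_of_mono_fac h
  -- The retraction splits Z as L ⊞ coker i, so indecomposability forces coker i = 0.
  let S := ShortComplex.mk i (cokernel.π i) (cokernel.condition i)
  have hS : S.Exact := S.exact_of_g_is_cokernel (cokernelIsCokernel i)
  let σ := ShortComplex.Splitting.ofExactOfRetraction S hS r h
    (inferInstanceAs (Epi (cokernel.π i)))
  have hc : IsZero (cokernel i) := (hZ.2 _ _ σ.isoBinaryBiproduct).resolve_left hL
  have : Epi i := Preadditive.epi_of_isZero_cokernel i hc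
  have : IsIso i := isIso_of_mono_of_epi i
  exact ⟨(asIso i).symm⟩

/-- If the objects have a size that decreases along proper direct summands, then every object is a
finite direct sum of indecomposable objects. -/
lemma exists_indecomposable_decomposition (size : C → ℕ)
    (hsize : ∀ X Y Z : C, (X ≅ Y ⊞ Z) → ¬ IsZero Y → ¬ IsZero Z → size Y < size X ∧ size Z < size X)
    (X : C) : ∃ (ι : Type) (_ : Finite ι) (Z : ι → C), (∀ t, Indecomposable (Z t)) ∧
      Nonempty (X ≅ ⨁ Z) := by
  induction hn : size X using Nat.strong_induction_on generalizing X with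
  | _ n ih =>
    by_cases hX : IsZero X
    · refine ⟨Empty, inferInstance, Empty.elim, fun t => t.elim, ⟨hX.iso ?_⟩⟩
      exact (IsZero.iff_id_eq_zero _).2 (biproduct.hom_ext _ _ isEmptyElim)
    by_cases hI : Indecomposable X
    · exact ⟨Unit, inferInstance, fun _ => X, fun _ => hI,
        ⟨(biproductUniqueIso fun _ : Unit => X).symm⟩⟩
    obtain ⟨Y, W, e, hY, hW⟩ : ∃ (Y W : C) (_ : X ≅ Y ⊞ W), ¬ IsZero Y ∧ ¬ IsZero W := by
      by_contra hne
      refine hI ⟨hX, fun Y W e => ?_⟩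
      by_contra hYW
      rw [not_or] at hYW
      exact hne ⟨Y, W, e, hYW⟩
    obtain ⟨hYX, hWX⟩ := hsize X Y W e hY hW
    obtain ⟨ι, _, Z, hZ, ⟨eY⟩⟩ := ih _ (hn ▸ hYX) Y rfl
    obtain ⟨κ, _, V, hV, ⟨eW⟩⟩ := ih _ (hn ▸ hWX) W rfl
    exact ⟨ι ⊕ κ, inferInstance, Sum.elim Z V, Sum.rec hZ hV,
      ⟨e ≪≫ biprod.mapIso eY eW ≪≫ biproductSumIso (Sum.elim Z V)⟩⟩

end Decomposition

/-! ### Total dimension as a measure for decompositions -/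

section TotalDimension

variable {k : Type u} [Field k] {D : Type} [Category.{0} D] [Finite D]

/-- The sum of the dimensions of the spaces of a functor. -/
noncomputable def totalDim (M : D ⥤ FGModuleCat.{u} k) : ℕ :=
  let _ := Fintype.ofFinite D
  ∑ p, Module.finrank k (M.obj p)

/-- The projections and inclusions of the biproduct, evaluated at p, give mutually inverse linear
maps to and from the product space. -/
lemma totalDim_eq_of_iso_biprod {M N L : D ⥤ FGModuleCat.{u} k} (e : M ≅ N ⊞ L) :
    totalDim M = totalDim N + totalDim L := by
  have h (p : D) : Module.finrank k (M.obj p) =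
      Module.finrank k (N.obj p) + Module.finrank k (L.obj p) := by
    rw [← Module.finrank_prod]
    refine (LinearEquiv.ofLinearMap
      ((appLin (e.hom ≫ biprod.fst) p).prod (appLin (e.hom ≫ biprod.snd) p))
      ((appLin (biprod.inl ≫ e.inv) p).coprod (appLin (biprod.inr ≫ e.inv) p)) ?_ ?_).finrank_eq
    · refine LinearMap.prod_ext ?_ ?_ <;> refine LinearMap.ext fun m => Prod.ext ?_ ?_ <;>
      simp [← appLin_comp_apply, appLin_id, appLin_zero,
        -ObjectProperty.FullSubcategory.comp_hom]
    · refine LinearMap.ext fun m => ?_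
      have ht : (e.hom ≫ biprod.fst) ≫ (biprod.inl ≫ e.inv) +
          (e.hom ≫ biprod.snd) ≫ (biprod.inr ≫ e.inv) = 𝟙 M := by
        have := congrArg (fun g => e.hom ≫ g ≫ e.inv) (biprod.total (X := N) (Y := L))
        simpa only [Preadditive.add_comp, Preadditive.comp_add, Category.assoc, Category.id_comp,
          Iso.hom_inv_id] using this
      have := congrArg (fun g => appLin g p m) ht
      rw [appLin_add] at this
      exact this
  simp only [totalDim, h, Finset.sum_add_distrib]

lemma isZero_of_totalDim_eq_zero {M : D ⥤ FGModuleCat.{u} k} (h : totalDim M = 0) : IsZero M := by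
  refine (IsZero.iff_id_eq_zero M).2 (natTrans_ext_appLin fun p => LinearMap.ext fun m => ?_)
  have hp : Module.finrank k (M.obj p) = 0 := by
    let _ := Fintype.ofFinite D
    exact (Finset.sum_eq_zero_iff.1 h) p (Finset.mem_univ p)
  have := Module.finrank_zero_iff.1 hp
  exact Subsingleton.elim _ _

lemma exists_indecomposable_decomposition_functor (X : D ⥤ FGModuleCat.{u} k) :
    ∃ (ι : Type) (_ : Finite ι) (Z : ι → D ⥤ FGModuleCat.{u} k), (∀ t, Indecomposable (Z t)) ∧
      Nonempty (X ≅ ⨁ Z) := by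
  refine exists_indecomposable_decomposition totalDim (fun X Y Z e hY hZ => ?_) X
  have := totalDim_eq_of_iso_biprod e
  have : totalDim Y ≠ 0 := fun h => hY (isZero_of_totalDim_eq_zero h)
  have : totalDim Z ≠ 0 := fun h => hZ (isZero_of_totalDim_eq_zero h)
  omega

end TotalDimension

/-! ### Representations of the quiver `1 ⟵ 2 ⟶ 3 ⟵ 4 ⟶ 5` -/

section Quiver

variable {k : Type u} [Field k]

/-- The tautological zigzag in the path category of the quiver. -/
def quiverDiagram : ZigzagDiagram (Paths ZigzagVertex) where
  p1 := ZigzagVertex.v1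
  p2 := ZigzagVertex.v2
  p3 := ZigzagVertex.v3
  p4 := ZigzagVertex.v4
  p5 := ZigzagVertex.v5
  a1 := (Paths.of ZigzagVertex).map ZigzagArrow.α1
  a2 := (Paths.of ZigzagVertex).map ZigzagArrow.α2
  a3 := (Paths.of ZigzagVertex).map ZigzagArrow.α3
  a4 := (Paths.of ZigzagVertex).map ZigzagArrow.α4

/-- Packages the recursor on vertices, so that families are used only through their five values. -/
lemma exists_vertex_family (T : Paths ZigzagVertex → Type*) (t1 : T quiverDiagram.p1)
    (t2 : T quiverDiagram.p2) (t3 : T quiverDiagram.p3) (t4 : T quiverDiagram.p4)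
    (t5 : T quiverDiagram.p5) :
    ∃ t : ∀ v, T v, t quiverDiagram.p1 = t1 ∧ t quiverDiagram.p2 = t2 ∧ t quiverDiagram.p3 = t3 ∧
      t quiverDiagram.p4 = t4 ∧ t quiverDiagram.p5 = t5 :=
  ⟨@ZigzagVertex.rec T t1 t2 t3 t4 t5, rfl, rfl, rfl, rfl, rfl⟩

lemma vertex_induction {R : Paths ZigzagVertex → Prop} (h1 : R quiverDiagram.p1)
    (h2 : R quiverDiagram.p2) (h3 : R quiverDiagram.p3) (h4 : R quiverDiagram.p4)
    (h5 : R quiverDiagram.p5) (v : Paths ZigzagVertex) : R v :=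
  @ZigzagVertex.rec R h1 h2 h3 h4 h5 v

/-- Reduces compatibility with all paths to the four arrows. -/
lemma path_induction {R : ∀ ⦃p q : Paths ZigzagVertex⦄, (p ⟶ q) → Prop} (id : ∀ p, R (𝟙 p))
    (comp : ∀ ⦃p q r : Paths ZigzagVertex⦄ (f : p ⟶ q) (g : q ⟶ r), R f → R g → R (f ≫ g))
    (h1 : R quiverDiagram.a1) (h2 : R quiverDiagram.a2) (h3 : R quiverDiagram.a3)
    (h4 : R quiverDiagram.a4) ⦃p q : Paths ZigzagVertex⦄ (f : p ⟶ q) : R f :=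
  Paths.induction (fun f => R f) (id _) (fun {_ v w} f a hf =>
    have h : ∀ a : ZigzagArrow v w, R ((Paths.of ZigzagVertex).map a) := by
      rintro (_ | _)
      exacts [h1, h2, h3, h4]
    comp _ _ hf (h a)) f

instance : Finite (Paths ZigzagVertex) := by
  refine Finite.of_surjective (fun i : Fin 5 => ![quiverDiagram.p1, quiverDiagram.p2,
    quiverDiagram.p3, quiverDiagram.p4, quiverDiagram.p5] i) fun v => ?_
  induction v using vertex_induction
  exacts [⟨0, rfl⟩, ⟨1, rfl⟩, ⟨2, rfl⟩, ⟨3, rfl⟩, ⟨4, rfl⟩]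

/-! ### The full interval module as a summand -/

section FullModule

variable {P : Type*} [PartialOrder P] (F : Paths ZigzagVertex ⥤ P) (J : PosetInterval P)

/-- If the multiplicity of the full interval module in `Z` is nonzero, then that module is a retract
of `Z`. -/
lemma exists_retract_of_mult_ne_zero (hJ : ∀ v, F.obj v ∈ J.1)
    {Z : Paths ZigzagVertex ⥤ FGModuleCat.{u} k} (hZ : quiverDiagram.mult Z ≠ 0) :
    ∃ (i : F ⋙ intervalModule k J ⟶ Z) (r : Z ⟶ F ⋙ intervalModule k J), i ≫ r = 𝟙 _ := by
  obtain ⟨a, b, hab, hn⟩ := quiverDiagram.exists_of_mult_ne_zero hZ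
  -- φ is nonzero on the common middle image and vanishes on the images of both outer kernels.
  obtain ⟨φ, hφ, hker⟩ := Submodule.exists_le_ker_of_notMem hn
  -- A functional vanishing on ker f extends along f; this carries φ to the outer vertices.
  have factor {V W : Type u} [AddCommGroup V] [Module k V] [AddCommGroup W] [Module k W]
      (f : V →ₗ[k] W) (g : V →ₗ[k] k) (h : ∀ v, f v = 0 → g v = 0) :
      ∃ g' : W →ₗ[k] k, ∀ v, g' (f v) = g v := by
    have : g ∈ LinearMap.range f.dualMap := by
      rw [LinearMap.range_dualMap_eq_dualAnnihilator_ker, Submodule.mem_dualAnnihilator]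
      exact h
    obtain ⟨g', rfl⟩ := this
    exact ⟨g', fun _ => rfl⟩
  obtain ⟨φ1, h1⟩ := factor (mapLin Z quiverDiagram.a1) (φ ∘ₗ mapLin Z quiverDiagram.a2)
    fun v hv => hker (Submodule.mem_sup_left ⟨v, hv, rfl⟩)
  obtain ⟨φ5, h5⟩ := factor (mapLin Z quiverDiagram.a4) (φ ∘ₗ mapLin Z quiverDiagram.a3)
    fun v hv => hker (Submodule.mem_sup_right ⟨v, hv, rfl⟩)
  generalize hc : φ (mapLin Z quiverDiagram.a2 a) = c at hφ
  -- The compatible elements s define a map L → Z and the compatible functionals ψ a map Z → L.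
  -- Their composite is the scalar c at every vertex, whence the factor c⁻¹ in `r`.
  obtain ⟨s, hs1, hs2, hs3, hs4, hs5⟩ := exists_vertex_family (fun v => Z.obj v)
    (mapLin Z quiverDiagram.a1 a) a (mapLin Z quiverDiagram.a2 a) b (mapLin Z quiverDiagram.a4 b)
  obtain ⟨ψ, hψ1, hψ2, hψ3, hψ4, hψ5⟩ := exists_vertex_family (fun v => Z.obj v →ₗ[k] k)
    φ1 (φ ∘ₗ mapLin Z quiverDiagram.a2) φ (φ ∘ₗ mapLin Z quiverDiagram.a3) φ5
  have hs ⦃v w : Paths ZigzagVertex⦄ (f : v ⟶ w) : mapLin Z f (s v) = s w := by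
    induction f using path_induction with
    | id p => exact mapLin_id Z p _
    | comp f g hf hg => rw [mapLin_comp, hf, hg]
    | h1 => rw [hs2, hs1]
    | h2 => rw [hs2, hs3]
    | h3 => rw [hs4, hs3, hab]
    | h4 => rw [hs4, hs5]
  have hψ ⦃v w : Paths ZigzagVertex⦄ (f : v ⟶ w) (m : Z.obj v) :
      ψ w (mapLin Z f m) = ψ v m := by
    induction f using path_induction with
    | id p => rw [mapLin_id]
    | comp f g hf hg => rw [mapLin_comp, hg, hf]
    | h1 => rw [hψ1, hψ2, h1]
    | h2 => rw [hψ3, hψ2, LinearMap.comp_apply]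
    | h3 => rw [hψ3, hψ4, LinearMap.comp_apply]
    | h4 => rw [hψ5, hψ4, h5]
  have hψs (v : Paths ZigzagVertex) : ψ v (s v) = c := by
    induction v using vertex_induction
    · rw [hψ1, hs1, h1, LinearMap.comp_apply, hc]
    · rw [hψ2, hs2, LinearMap.comp_apply, hc]
    · rw [hψ3, hs3, hc]
    · rw [hψ4, hs4, LinearMap.comp_apply, ← hab, hc]
    · rw [hψ5, hs5, h5, LinearMap.comp_apply, ← hab, hc]
  let L := F ⋙ intervalModule k J
  let i : L ⟶ Z := natTransOfLin
    (fun v => (LinearMap.toSpanSingleton k _ (s v)) ∘ₗ intervalModuleCoord k J (hJ v))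
    (fun v w f m => by
      have h := intervalModuleCoord_mapLin J (F.map f) (hJ v) (hJ w) m
      change intervalModuleCoord k J (hJ w) (mapLin (intervalModule k J) (F.map f) m) • s w =
        mapLin Z f (intervalModuleCoord k J (hJ v) m • s v)
      rw [h, map_smul, hs])
  let r : Z ⟶ L := natTransOfLin
    (fun v => (LinearMap.toSpanSingleton k (L.obj v) (c⁻¹ • intervalModuleOne k J (F.obj v))) ∘ₗ ψ v)
    (fun v w f m => by
      have h : mapLin (intervalModule k J) (F.map f) (intervalModuleOne k J (F.obj v)) = _ :=
        (isSection_intervalModuleOne J).map_eq (leOfHom (F.map f)) (hJ v)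
      change ψ w (mapLin Z f m) • c⁻¹ • intervalModuleOne k J (F.obj w) =
        mapLin (intervalModule k J) (F.map f) (ψ v m • c⁻¹ • intervalModuleOne k J (F.obj v))
      rw [hψ, map_smul, map_smul, h])
  refine ⟨i, r, natTrans_ext_appLin fun v => LinearMap.ext fun m => ?_⟩
  have hm := intervalModule_eq_smul_one (hJ v) m
  change ψ v (intervalModuleCoord k J (hJ v) m • s v) •
    c⁻¹ • intervalModuleOne k J (F.obj v) = m
  rw [map_smul, hψs, smul_smul, smul_eq_mul, mul_assoc, mul_inv_cancel₀ hφ, mul_one]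
  exact hm.symm

/-- The number of summands isomorphic to the full interval module in a decomposition into
indecomposables. -/
lemma eq_mult_of_hasMultiplicity (hJ : ∀ v, F.obj v ∈ J.1)
    (hmult : quiverDiagram.mult (F ⋙ intervalModule k J) = 1)
    {X : Paths ZigzagVertex ⥤ FGModuleCat.{u} k} {m : ℕ}
    (h : HasMultiplicity X (F ⋙ intervalModule k J) m) : (m : ℤ) = quiverDiagram.mult X := by
  classical
  obtain ⟨ι, _, Z, hZ, ⟨e⟩, rfl⟩ := h
  have := Fintype.ofFinite ι
  have hL : ¬ IsZero (F ⋙ intervalModule k J) := fun h => by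
    rw [quiverDiagram.mult_of_isZero h] at hmult
    exact zero_ne_one hmult
  -- Each indecomposable summand contributes 1 or 0, so additivity turns `mult` into a count.
  have hone (t : ι) : quiverDiagram.mult (Z t) =
      if Nonempty (Z t ≅ F ⋙ intervalModule k J) then 1 else 0 := by
    split_ifs with ht
    · obtain ⟨e⟩ := ht
      rw [quiverDiagram.mult_congr e, hmult]
    · by_contra hne
      obtain ⟨i, r, hir⟩ := exists_retract_of_mult_ne_zero F J hJ hne
      exact ht (nonempty_iso_of_retract (hZ t) hL i r hir)
  rw [quiverDiagram.mult_congr e, quiverDiagram.mult_biproduct]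
  simp only [hone, Finset.sum_boole, Nat.card_eq_fintype_card, Fintype.card_subtype]

lemma exists_hasMultiplicity (X L : Paths ZigzagVertex ⥤ FGModuleCat.{u} k) :
    ∃ m, HasMultiplicity X L m := by
  obtain ⟨ι, _, Z, hZ, e⟩ := exists_indecomposable_decomposition_functor X
  exact ⟨_, ι, inferInstance, Z, hZ, e, rfl⟩

/-- The image of the tautological zigzag under a functor. -/
def imageDiagram : ZigzagDiagram P where
  p1 := F.obj quiverDiagram.p1
  p2 := F.obj quiverDiagram.p2
  p3 := F.obj quiverDiagram.p3
  p4 := F.obj quiverDiagram.p4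
  p5 := F.obj quiverDiagram.p5
  a1 := F.map quiverDiagram.a1
  a2 := F.map quiverDiagram.a2
  a3 := F.map quiverDiagram.a3
  a4 := F.map quiverDiagram.a4

/-- Bridges the quiver side, where summands are counted, and the poset side, where resolutions live.
-/
lemma mult_comp (M : P ⥤ FGModuleCat.{u} k) :
    quiverDiagram.mult (F ⋙ M) = (imageDiagram F).mult M := rfl

end FullModule

open Classical in
/-- If a zigzag in a finite poset spans the interval `I` and its middle target is the join of its
two sources, then the multiplicity of the restriction of `V_I` in the restriction of `M` is the
alternating sum of the multiplicities of the intervals containing `I` in an interval resolution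
of `M`. -/
theorem eq_sum_of_hasMultiplicity {P : Type} [PartialOrder P] [Finite P]
    (F : Paths ZigzagVertex ⥤ P) (I : PosetInterval P)
    (hz : ∀ q, F.obj quiverDiagram.p2 ≤ q → F.obj quiverDiagram.p4 ≤ q →
      F.obj quiverDiagram.p3 ≤ q)
    (hI : ∀ v, F.obj v ∈ I.1) (hIJ : ∀ J : PosetInterval P, (∀ v, F.obj v ∈ J.1) → I ≤ J)
    {M : P ⥤ FGModuleCat.{u} k} {r : ℕ} {d : ℕ → PosetInterval P → ℕ}
    (res : IntervalResolution M r d) {m : ℕ}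
    (hm : HasMultiplicity (F ⋙ M) (F ⋙ intervalModule k I) m) :
    (m : ℤ) = ∑ J : PosetInterval P with I ≤ J,
      ∑ i ∈ Finset.range (r + 1), (-1 : ℤ) ^ i * (d i J : ℤ) := by
  have hmult (J : PosetInterval P) :
      (imageDiagram F).mult (intervalModule k J) = if I ≤ J then 1 else 0 := by
    split_ifs with h
    · exact (imageDiagram F).mult_intervalModule_of_mem J (h (hI _)) (h (hI _)) (h (hI _))
        (h (hI _)) (h (hI _))
    · by_contra hne
      obtain ⟨h1, h2, h3, h4, h5⟩ :=
        (imageDiagram F).mem_of_mult_intervalModule_ne_zero hne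
      exact h (hIJ J (vertex_induction h1 h2 h3 h4 h5))
  rw [eq_mult_of_hasMultiplicity F I hI ((mult_comp F _).trans ((hmult I).trans (if_pos le_rfl))) hm,
    mult_comp, (imageDiagram F).mult_eq_sum_of_resolution hz res]
  simp only [ZigzagDiagram.mult_intervalSum, hmult, mul_ite, mul_one, mul_zero]
  rw [Finset.sum_comm]
  refine Finset.sum_congr rfl fun i _ => ?_
  rw [← Finset.mul_sum, Finset.sum_filter]

end Quiver

/-! ### The commutative ladder -/

namespace Ladder

variable {n : ℕ}

/-- With both rows present, an upper bound of y_k is some y_c, and x_i ≤ y_c gives i ≤ c, so y_i is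
the join. Otherwise the middle vertex has the same image as vertex 2. -/
lemma xi_le_of_le (I : PosetInterval (Ladder n)) (q : Ladder n) (h2 : (xi I).obj .v2 ≤ q)
    (h4 : (xi I).obj .v4 ≤ q) : (xi I).obj .v3 ≤ q := by
  unfold xi at *
  split_ifs at * with hl hu
  · rcases eq_x_or_y q with ⟨c, rfl⟩ | ⟨c, rfl⟩
    · exact absurd h2 (not_y_le_x _ _)
    · exact y_le_y (le_of_x_le_y h4)
  · exact h2
  · exact h2

lemma xi_mem (I : PosetInterval (Ladder n)) (v : ZigzagVertex) : (xi I).obj v ∈ I.1 := by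
  unfold xi
  split_ifs with hl hu
  · have hx1 := mem_lower.1 ((lower I).min'_mem hl)
    have hx2 := mem_lower.1 ((lower I).max'_mem hl)
    have hy1 := mem_upper.1 ((upper I).min'_mem hu)
    have hy2 := mem_upper.1 ((upper I).max'_mem hu)
    -- Only y_i needs an argument: a walk between the rows yields x_a ≤ y_b in I, and i ≤ a ≤ b
    -- places y_i between x_i and y_b.
    obtain ⟨w⟩ := I.2.1.preconnected ⟨_, hx1⟩ ⟨_, hy1⟩
    obtain ⟨a, b, ha, hb, hab⟩ := exists_x_le_y_of_walk w ⟨_, rfl⟩ ⟨_, rfl⟩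
    have hy3 : y ((lower I).min' hl) ∈ I.1 := I.2.2.out hx1 hb
      ⟨x_le_y le_rfl, y_le_y (((lower I).min'_le a (mem_lower.2 ha)).trans hab)⟩
    cases v
    exacts [hy2, hy1, hy3, hx1, hx2]
  · have hx1 := mem_lower.1 ((lower I).min'_mem hl)
    have hx2 := mem_lower.1 ((lower I).max'_mem hl)
    cases v
    exacts [hx2, hx1, hx1, hx1, hx2]
  · have hu := upper_nonempty_of_lower_empty I hl
    have hy1 := mem_upper.1 ((upper I).min'_mem hu)
    have hy2 := mem_upper.1 ((upper I).max'_mem hu)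
    cases v
    exacts [hy2, hy1, hy1, hy1, hy2]

/-- The zigzag visits both ends of each row of I, and convexity of J fills in the rows. -/
lemma le_of_forall_xi_mem (I J : PosetInterval (Ladder n)) (h : ∀ v, (xi I).obj v ∈ J.1) :
    I ≤ J := by
  intro p hp
  have lower_mem (hl : (lower I).Nonempty) (h1 : x ((lower I).min' hl) ∈ J.1)
      (h2 : x ((lower I).max' hl) ∈ J.1) {a : Fin n} (ha : a ∈ lower I) : x a ∈ J.1 :=
    J.2.2.out h1 h2 ⟨x_le_x ((lower I).min'_le a ha), x_le_x ((lower I).le_max' a ha)⟩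
  have upper_mem (hu : (upper I).Nonempty) (h1 : y ((upper I).min' hu) ∈ J.1)
      (h2 : y ((upper I).max' hu) ∈ J.1) {a : Fin n} (ha : a ∈ upper I) : y a ∈ J.1 :=
    J.2.2.out h1 h2 ⟨y_le_y ((upper I).min'_le a ha), y_le_y ((upper I).le_max' a ha)⟩
  unfold xi at h
  rcases eq_x_or_y p with ⟨a, rfl⟩ | ⟨a, rfl⟩
  · have ha := mem_lower.2 hp
    split_ifs at h with hl hu
    · exact lower_mem hl (h .v4) (h .v5) ha
    · exact lower_mem hl (h .v4) (h .v5) ha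
    · exact absurd ⟨a, ha⟩ hl
  · have ha := mem_upper.2 hp
    split_ifs at h with hl hu
    · exact upper_mem hu (h .v2) (h .v1) ha
    · exact absurd ⟨a, ha⟩ hu
    · exact upper_mem _ (h .v2) (h .v1) ha

end Ladder

open Classical in
theorem mainTheorem4 {k : Type u} [Field k] (n : ℕ) (M : Ladder n ⥤ FGModuleCat.{u} k)
    (r : ℕ) (d : ℕ → PosetInterval (Ladder n) → ℕ) (_res : IntervalResolution M r d)
    (I : PosetInterval (Ladder n)) :
    HasMultiplicity ((Ladder.compression k I).obj M)
        ((Ladder.compression k I).obj (intervalModule k I)) (Ladder.compressedMultiplicity M I) ∧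
      (Ladder.compressedMultiplicity M I : ℤ) =
        ∑ J : PosetInterval (Ladder n) with I ≤ J,
          ∑ i ∈ Finset.range (r + 1), (-1 : ℤ) ^ i * (d i J : ℤ) := by
  have h : HasMultiplicity ((Ladder.compression k I).obj M)
      ((Ladder.compression k I).obj (intervalModule k I)) (Ladder.compressedMultiplicity M I) := by
    -- Existence of a decomposition rules out the default value 0 in `krullSchmidtMultiplicity`.
    have hex := exists_hasMultiplicity ((Ladder.compression k I).obj M)
      ((Ladder.compression k I).obj (intervalModule k I))
    rw [Ladder.compressedMultiplicity, krullSchmidtMultiplicity, dif_pos hex]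
    exact hex.choose_spec
  exact ⟨h, eq_sum_of_hasMultiplicity (Ladder.compressionFunctor I) I (Ladder.xi_le_of_le I)
    (Ladder.xi_mem I) (Ladder.le_of_forall_xi_mem I) _res h⟩
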